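/- Let $p$ be a prime number. A graph $X$ is a finite multigraph in Serre's sense: finite sets $V_X$ of vertices and $\mathbb{E}_X$ of oriented edges, a fixed-point-free involution $e \mapsto \bar e$ of $\mathbb{E}_X$, and maps $s,t : \mathbb{E}_X \to V_X$ with $s(\bar e)=t(e)$, $t(\bar e)=s(e)$; $\kappa_X$ denotes its number of spanning trees. Put $\Gamma=\mathbb{Z}_p$ (written multiplicatively) and $\Gamma_n=\Gamma/\Gamma^{p^n}\simeq \mathbb{Z}/p^n\mathbb{Z}$. Given a graph $X$, a voltage assignment $\alpha : \mathbb{E}_X \to \Gamma$ (a map with $\alpha(\bar e)=\alpha(e)^{-1}$) and a family $\mathcal{I}=(I_v)_{v\in V_X}$ of subgroups of $\Gamma$ with images $I_{v,n}\subset\Gamma_n$, the derived graph $X_n$ ($n \ge 0$) is given by $$V_{X_n}=\coprod_{v\in V_X}\bigl(\Gamma_n/I_{v,n}\times\{v\}\bigr),\qquad \mathbb{E}_{X_n}=\Gamma_n\times\mathbb{E}_X,$$ $$\overline{(\gamma,e)}=(\gamma\alpha(e),\bar e),\quad s(\gamma,e)=(\gamma I_{s(e),n},s(e)),\quad t(\gamma,e)=(\gamma\alpha(e)I_{t(e),n},t(e)).$$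 With the projections $X_{n+1}\to X_n$ and the translation action of $\Gamma_n$ on $X_n$ over $X = X_0$, the tower $X = X_0\leftarrow X_1\leftarrow X_2\leftarrow\cdots$ is a (ramified) $\mathbb{Z}_p$-covering $X_\infty/X$; it is a covering of connected graphs if all $X_n$ are connected. A vertex $v$ of $X$ is unramified if $I_v=1$ and totally ramified if $I_v=\Gamma$. We write $\lambda(X_\infty/X)=\lambda$ and $\mu(X_\infty/X)=\mu$ if there is an integer $\nu$ with $$\mathrm{ord}_p(\kappa_{X_n})=\lambda n+\mu p^n+\nu\quad\text{for all sufficiently large } n.$$ Theorem. For every prime $p$, every even integer $\lambda\ge 0$ and every integer $\mu\ge 0$, there exists a (ramified) $\mathbb{Z}_p$-covering $X_\infty/X$ of connected graphs, given by a voltage assignment $\alpha$ and a family $\mathcal{I}$ as above, with $\lambda(X_\infty/X)=\lambda$ and $\mu(X_\infty/X)=\mu$, such that $X$ has exactly two vertices, one of them unramified and the other totally ramified in $X_\infty/X$. -/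

import Mathlib

/-- A (finite multi)graph in Serre's formalism: finite sets of vertices and of oriented edges, a
fixed-point free involution `bar` on the edges, and source and target maps exchanged by `bar`. -/
structure SerreGraph where
  V : Type
  E : Type
  finite_V : Finite V
  finite_E : Finite E
  bar : E → E
  s : E → V
  t : E → V
  bar_bar : ∀ e, bar (bar e) = e
  bar_ne : ∀ e, bar e ≠ e
  s_bar : ∀ e, s (bar e) = t e
  t_bar : ∀ e, t (bar e) = s e

namespace SerreGraph

attribute [instance] SerreGraph.finite_V SerreGraph.finite_E

/-- `X.Joined F u v`: there is a walk from `u` to `v` all of whose edges lie in `F`. -/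
def Joined (X : SerreGraph) (F : Set X.E) : X.V → X.V → Prop :=
  Relation.ReflTransGen (fun u v => ∃ e ∈ F, X.s e = u ∧ X.t e = v)

/-- The spanning subgraph with edge set `F` is connected (in particular it has a vertex). -/
def ConnectedBy (X : SerreGraph) (F : Set X.E) : Prop :=
  Nonempty X.V ∧ ∀ u v : X.V, X.Joined F u v

/-- A connected graph. -/
def IsConnected (X : SerreGraph) : Prop := X.ConnectedBy Set.univ

/-- `F` is the edge set of a spanning tree: it is stable under the involution, the spanning
subgraph `(V, F)` is connected, and it has no circuit, i.e. no edge of `F` has its two ends joined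
by a walk in `F` that avoids this edge (in both orientations). A loop is such a circuit. -/
structure IsSpanningTree (X : SerreGraph) (F : Set X.E) : Prop where
  bar_mem : ∀ e ∈ F, X.bar e ∈ F
  connected : X.ConnectedBy F
  acyclic : ∀ e ∈ F, ¬ X.Joined (F \ {e, X.bar e}) (X.s e) (X.t e)

/-- The number `κ_X` of spanning trees of `X`. -/
noncomputable def kappa (X : SerreGraph) : ℕ := {F : Set X.E | X.IsSpanningTree F}.ncard

/-- Morphisms of graphs. -/
structure Hom (Y X : SerreGraph) where
  onV : Y.V → X.V
  onE : Y.E → X.E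
  map_bar : ∀ e, onE (Y.bar e) = X.bar (onE e)
  map_s : ∀ e, onV (Y.s e) = X.s (onE e)
  map_t : ∀ e, onV (Y.t e) = X.t (onE e)

/-- A voltage assignment `α : 𝔼_X → G`, i.e. a map with `α(ē) = α(e)⁻¹`. -/
structure Voltage (X : SerreGraph) (G : Type) [Group G] where
  toFun : X.E → G
  map_bar : ∀ e, toFun (X.bar e) = (toFun e)⁻¹

/-- The voltage assignment `φ ∘ α`. -/
def Voltage.map {X : SerreGraph} {G H : Type} [Group G] [Group H] (α : X.Voltage G) (φ : G →* H) :
    X.Voltage H where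
  toFun := fun e => φ (α.toFun e)
  map_bar := fun e => by rw [α.map_bar, map_inv]

section Derived

variable {X : SerreGraph} {G H : Type} [CommGroup G] [CommGroup H]

theorem sigma_mk_congr (J : X.V → Subgroup G) {v w : X.V} {g h : G} (hv : v = w) (hg : g = h) :
    (⟨v, QuotientGroup.mk g⟩ : Σ v : X.V, G ⧸ J v) = ⟨w, QuotientGroup.mk h⟩ := by
  subst hv hg
  rfl

/-- The derived graph of a voltage assignment `α` with values in a finite abelian group `G` and a
family `J = (J_v)_v` of subgroups of `G`: its vertices over `v` are the cosets `G / J_v`, its edges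
are the pairs `(g, e)`, and `(g, e)` goes from `g J_{s(e)}` to `g α(e) J_{t(e)}`, with opposite edge
`(g α(e), ē)`. -/
def derived [Finite G] (α : X.Voltage G) (J : X.V → Subgroup G) : SerreGraph where
  V := Σ v : X.V, G ⧸ J v
  E := G × X.E
  finite_V := inferInstance
  finite_E := inferInstance
  bar := fun q => (q.1 * α.toFun q.2, X.bar q.2)
  s := fun q => ⟨X.s q.2, QuotientGroup.mk q.1⟩
  t := fun q => ⟨X.t q.2, QuotientGroup.mk (q.1 * α.toFun q.2)⟩
  bar_bar := by
    rintro ⟨g, e⟩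
    simp [α.map_bar, X.bar_bar]
  bar_ne := by
    rintro ⟨g, e⟩ h
    exact X.bar_ne e (congrArg Prod.snd h)
  s_bar := by
    rintro ⟨g, e⟩
    exact sigma_mk_congr J (X.s_bar e) rfl
  t_bar := by
    rintro ⟨g, e⟩
    exact sigma_mk_congr J (X.t_bar e)
      (show g * α.toFun e * α.toFun (X.bar e) = g by rw [α.map_bar, mul_inv_cancel_right])

/-- Translation action of `G` on the vertices of the derived graph. -/
instance derivedActV [Finite G] (α : X.Voltage G) (J : X.V → Subgroup G) :
    MulAction G (derived α J).V where
  smul := fun g (x : Σ v : X.V, G ⧸ J v) => (⟨x.1, g • x.2⟩ : Σ v : X.V, G ⧸ J v)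
  one_smul := fun x => Sigma.ext rfl (heq_of_eq (one_smul G x.2))
  mul_smul := fun g h x => Sigma.ext rfl (heq_of_eq (mul_smul g h x.2))

/-- Translation action of `G` on the edges of the derived graph. -/
instance derivedActE [Finite G] (α : X.Voltage G) (J : X.V → Subgroup G) :
    MulAction G (derived α J).E where
  smul := fun g (q : G × X.E) => ((g * q.1, q.2) : G × X.E)
  one_smul := fun q => Prod.ext (one_mul q.1) rfl
  mul_smul := fun g h q => Prod.ext (mul_assoc g h q.1) rfl

/-- The projection of the derived graph to `X`. -/
def derivedToBase [Finite G] (α : X.Voltage G) (J : X.V → Subgroup G) : (derived α J).Hom X where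
  onV := fun (x : Σ v : X.V, G ⧸ J v) => x.1
  onE := fun (q : G × X.E) => q.2
  map_bar := fun _ => rfl
  map_s := fun _ => rfl
  map_t := fun _ => rfl

/-- The map of derived graphs induced by a homomorphism `φ : G → H`. -/
def derivedMap [Finite G] [Finite H] (α : X.Voltage G) (J : X.V → Subgroup G) (β : X.Voltage H)
    (K : X.V → Subgroup H) (φ : G →* H) (hα : ∀ e, φ (α.toFun e) = β.toFun e)
    (hJ : ∀ v, J v ≤ (K v).comap φ) : (derived α J).Hom (derived β K) where
  onV := fun (x : Σ v : X.V, G ⧸ J v) =>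
    (⟨x.1, QuotientGroup.map (J x.1) (K x.1) φ (hJ x.1) x.2⟩ : Σ v : X.V, H ⧸ K v)
  onE := fun (q : G × X.E) => ((φ q.1, q.2) : H × X.E)
  map_bar := by
    rintro ⟨g, e⟩
    exact Prod.ext (show φ (g * α.toFun e) = φ g * β.toFun e by rw [map_mul, hα]) rfl
  map_s := fun _ => rfl
  map_t := by
    rintro ⟨g, e⟩
    exact sigma_mk_congr K rfl (show φ (g * α.toFun e) = φ g * β.toFun e by rw [map_mul, hα])

variable [Finite G] [Finite H] (α : X.Voltage G) (J : X.V → Subgroup G) (β : X.Voltage H)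
  (K : X.V → Subgroup H) (φ : G →* H)

theorem derived_smul_s (g : G) (e : (derived α J).E) :
    (derived α J).s (g • e) = g • (derived α J).s e := rfl

theorem derived_smul_t (g : G) (e : (derived α J).E) :
    (derived α J).t (g • e) = g • (derived α J).t e := by
  obtain ⟨h, e⟩ := e
  exact sigma_mk_congr J rfl (mul_assoc g h (α.toFun e))

theorem derived_smul_bar (g : G) (e : (derived α J).E) :
    (derived α J).bar (g • e) = g • (derived α J).bar e := by
  obtain ⟨h, e⟩ := e
  exact Prod.ext (mul_assoc g h (α.toFun e)) rfl

theorem derived_free (g : G) (e : (derived α J).E) (h : g • e = e) : g = 1 := by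
  obtain ⟨k, e⟩ := e
  exact mul_eq_right.1 (congrArg Prod.fst h)

theorem derived_surjV : Function.Surjective (derivedToBase α J).onV :=
  fun v => ⟨(⟨v, QuotientGroup.mk 1⟩ : Σ v : X.V, G ⧸ J v), rfl⟩

theorem derived_surjE : Function.Surjective (derivedToBase α J).onE :=
  fun e => ⟨((1, e) : G × X.E), rfl⟩

theorem derived_fibreV (x y : (derived α J).V) :
    (derivedToBase α J).onV x = (derivedToBase α J).onV y ↔ ∃ g : G, g • x = y := by
  obtain ⟨v, x⟩ := x
  obtain ⟨w, y⟩ := y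
  constructor
  · intro h
    obtain rfl : v = w := h
    obtain ⟨g, hg⟩ := MulAction.exists_smul_eq G x y
    exact ⟨g, Sigma.ext rfl (heq_of_eq hg)⟩
  · rintro ⟨g, hg⟩
    exact congrArg Sigma.fst hg

theorem derived_fibreE (e f : (derived α J).E) :
    (derivedToBase α J).onE e = (derivedToBase α J).onE f ↔ ∃ g : G, g • e = f := by
  obtain ⟨g, e⟩ := e
  obtain ⟨h, f⟩ := f
  constructor
  · intro H
    exact ⟨h * g⁻¹, Prod.ext (inv_mul_cancel_right h g) H⟩
  · rintro ⟨k, hk⟩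
    exact congrArg Prod.snd hk

variable (hα : ∀ e, φ (α.toFun e) = β.toFun e) (hJ : ∀ v, J v ≤ (K v).comap φ)

theorem derivedMap_toBaseV (x : (derived α J).V) :
    (derivedToBase β K).onV ((derivedMap α J β K φ hα hJ).onV x) = (derivedToBase α J).onV x := rfl

theorem derivedMap_toBaseE (e : (derived α J).E) :
    (derivedToBase β K).onE ((derivedMap α J β K φ hα hJ).onE e) = (derivedToBase α J).onE e := rfl

theorem derivedMap_smulV (g : G) (x : (derived α J).V) :
    (derivedMap α J β K φ hα hJ).onV (g • x) = φ g • (derivedMap α J β K φ hα hJ).onV x := by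
  obtain ⟨v, x⟩ := x
  obtain ⟨x, rfl⟩ := QuotientGroup.mk_surjective x
  exact sigma_mk_congr K rfl (map_mul φ g x)

theorem derivedMap_smulE (g : G) (e : (derived α J).E) :
    (derivedMap α J β K φ hα hJ).onE (g • e) = φ g • (derivedMap α J β K φ hα hJ).onE e := by
  obtain ⟨h, e⟩ := e
  exact Prod.ext (map_mul φ g h) rfl

theorem derivedMap_surjV (hφ : Function.Surjective φ) :
    Function.Surjective (derivedMap α J β K φ hα hJ).onV := by
  rintro ⟨v, x⟩
  obtain ⟨x, rfl⟩ := QuotientGroup.mk_surjective x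
  obtain ⟨g, rfl⟩ := hφ x
  exact ⟨(⟨v, QuotientGroup.mk g⟩ : Σ v : X.V, G ⧸ J v), rfl⟩

theorem derivedMap_surjE (hφ : Function.Surjective φ) :
    Function.Surjective (derivedMap α J β K φ hα hJ).onE := by
  rintro ⟨x, e⟩
  obtain ⟨g, rfl⟩ := hφ x
  exact ⟨((g, e) : G × X.E), rfl⟩

theorem derivedMap_fibreV (hK : ∀ v, K v = (J v).map φ) (x y : (derived α J).V) :
    (derivedMap α J β K φ hα hJ).onV x = (derivedMap α J β K φ hα hJ).onV y ↔
      ∃ g ∈ φ.ker, g • x = y := by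
  constructor
  · obtain ⟨v, x⟩ := x
    obtain ⟨w, y⟩ := y
    obtain ⟨x, rfl⟩ := QuotientGroup.mk_surjective x
    obtain ⟨y, rfl⟩ := QuotientGroup.mk_surjective y
    intro h
    obtain rfl : v = w := congrArg Sigma.fst h
    have h2 : (QuotientGroup.mk (φ x) : H ⧸ K v) = QuotientGroup.mk (φ y) :=
      eq_of_heq (Sigma.ext_iff.1 h).2
    rw [QuotientGroup.eq, hK] at h2
    obtain ⟨i, hi, hi2⟩ := h2
    refine ⟨y * i⁻¹ * x⁻¹, ?_, Sigma.ext rfl (heq_of_eq ?_)⟩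
    · rw [MonoidHom.mem_ker, map_mul, map_mul, map_inv, map_inv, hi2, mul_inv_rev, inv_inv]
      simp
    · refine QuotientGroup.eq.2 ?_
      have : (y * i⁻¹ * x⁻¹ * x)⁻¹ * y = i := by simp
      exact this.symm ▸ hi
  · rintro ⟨g, hg, rfl⟩
    rw [derivedMap_smulV, MonoidHom.mem_ker.1 hg, one_smul]

theorem derivedMap_fibreE (e f : (derived α J).E) :
    (derivedMap α J β K φ hα hJ).onE e = (derivedMap α J β K φ hα hJ).onE f ↔
      ∃ g ∈ φ.ker, g • e = f := by
  constructor
  · obtain ⟨g, e⟩ := e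
    obtain ⟨h, f⟩ := f
    intro H
    have H1 : φ g = φ h := congrArg Prod.fst H
    have H2 : e = f := congrArg Prod.snd H
    refine ⟨h * g⁻¹, ?_, Prod.ext (inv_mul_cancel_right h g) H2⟩
    rw [MonoidHom.mem_ker, map_mul, map_inv, H1, mul_inv_cancel]
  · rintro ⟨k, hk, rfl⟩
    rw [derivedMap_smulE, MonoidHom.mem_ker.1 hk, one_smul]

end Derived

end SerreGraph

namespace ZpTower

variable (p : ℕ) [Fact p.Prime]

/-- The group `Γ ≅ ℤ_p`, written multiplicatively. -/
abbrev Gam : Type := Multiplicative ℤ_[p]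

/-- The subgroup `Γ^{p^n}` of `p^n`-th powers in `Γ`. -/
noncomputable abbrev GamPow (n : ℕ) : Subgroup (Gam p) := (powMonoidHom (p ^ n) : Gam p →* Gam p).range

/-- `Γ_n = Γ / Γ^{p^n}`. -/
abbrev GamQ (n : ℕ) : Type := Gam p ⧸ GamPow p n

/-- The projection `Γ → Γ_n`. -/
noncomputable abbrev proj (n : ℕ) : Gam p →* GamQ p n := QuotientGroup.mk' (GamPow p n)

theorem gamPow_eq_ker (n : ℕ) :
    GamPow p n =
      (AddMonoidHom.toMultiplicative (PadicInt.toZModPow (p := p) n).toAddMonoidHom).ker := by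
  ext x
  have h : x.toAdd ∈ RingHom.ker (PadicInt.toZModPow (p := p) n) ↔
      x.toAdd ∈ Ideal.span {(p : ℤ_[p]) ^ n} := by rw [PadicInt.ker_toZModPow]
  rw [RingHom.mem_ker, Ideal.mem_span_singleton'] at h
  have h2 : x ∈ (AddMonoidHom.toMultiplicative
      (PadicInt.toZModPow (p := p) n).toAddMonoidHom).ker ↔
      PadicInt.toZModPow (p := p) n x.toAdd = 0 := Iff.rfl
  rw [h2, h]
  constructor
  · rintro ⟨y, rfl⟩
    exact ⟨y.toAdd, by simp [mul_comm]⟩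
  · rintro ⟨a, ha⟩
    refine ⟨Multiplicative.ofAdd a, ?_⟩
    apply Multiplicative.toAdd.injective
    rw [← ha]
    simp [mul_comm]

/-- `Γ_n ≅ ℤ/p^n`. -/
noncomputable def gamQEquiv (n : ℕ) : GamQ p n ≃* Multiplicative (ZMod (p ^ n)) :=
  (QuotientGroup.quotientMulEquivOfEq (gamPow_eq_ker p n)).trans
    (QuotientGroup.quotientKerEquivOfSurjective _
      (fun y => by
        obtain ⟨x, hx⟩ := ZMod.ringHom_surjective (PadicInt.toZModPow (p := p) n) y.toAdd
        exact ⟨Multiplicative.ofAdd x, congrArg Multiplicative.ofAdd hx⟩))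

instance finite_gamQ (n : ℕ) : Finite (GamQ p n) :=
  haveI : NeZero (p ^ n) := ⟨pow_ne_zero _ (Fact.out : p.Prime).ne_zero⟩
  haveI : Finite (Multiplicative (ZMod (p ^ n))) := inferInstanceAs (Finite (ZMod (p ^ n)))
  Finite.of_equiv _ (gamQEquiv p n).symm.toEquiv

theorem gamPow_succ_le (n : ℕ) : GamPow p (n + 1) ≤ GamPow p n := by
  rintro _ ⟨y, rfl⟩
  exact ⟨y ^ p, by simp only [powMonoidHom_apply]; rw [← pow_mul, pow_succ']⟩

/-- The projection `Γ_{n+1} → Γ_n`. -/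
noncomputable def trans (n : ℕ) : GamQ p (n + 1) →* GamQ p n :=
  QuotientGroup.map _ _ (MonoidHom.id (Gam p)) (gamPow_succ_le p n)

@[simp] theorem trans_proj (n : ℕ) (g : Gam p) : trans p n (proj p (n + 1) g) = proj p n g := rfl

theorem trans_comp (n : ℕ) : (trans p n).comp (proj p (n + 1)) = proj p n :=
  MonoidHom.ext (trans_proj p n)

theorem trans_surjective (n : ℕ) : Function.Surjective (trans p n) := fun x => by
  obtain ⟨g, rfl⟩ := QuotientGroup.mk'_surjective (GamPow p n) x
  exact ⟨proj p (n + 1) g, trans_proj p n g⟩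

/-- A (possibly ramified) `ℤ_p`-covering `X_∞ / X`: a tower of graphs
`X ≅ X_0 ← X_1 ← X_2 ← ⋯` over `X`, where `X_n → X` is a Galois covering with Galois group
`Γ_n ≅ ℤ/p^n`. That is, `Γ_n` acts on the graph `X_n`, freely on the edges, and `X` is the quotient
of `X_n` by `Γ_n` (on vertices and on edges); stabilizers of vertices (ramification) are allowed.
Likewise `X_n` is, equivariantly, the quotient of `X_{n+1}` by the kernel of `Γ_{n+1} → Γ_n`.
For `n = 0` the group is trivial, so that `X_0 → X` is an isomorphism. -/
structure ZpCovering (X : SerreGraph) where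
  layer : ℕ → SerreGraph
  toBase : ∀ n, (layer n).Hom X
  down : ∀ n, (layer (n + 1)).Hom (layer n)
  toBase_downV : ∀ n x, (toBase n).onV ((down n).onV x) = (toBase (n + 1)).onV x
  toBase_downE : ∀ n e, (toBase n).onE ((down n).onE e) = (toBase (n + 1)).onE e
  actV : ∀ n, MulAction (GamQ p n) (layer n).V
  actE : ∀ n, MulAction (GamQ p n) (layer n).E
  smul_s : ∀ n (g : GamQ p n) (e : (layer n).E), (layer n).s (g • e) = g • (layer n).s e
  smul_t : ∀ n (g : GamQ p n) (e : (layer n).E), (layer n).t (g • e) = g • (layer n).t e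
  smul_bar : ∀ n (g : GamQ p n) (e : (layer n).E), (layer n).bar (g • e) = g • (layer n).bar e
  down_smulV : ∀ n (g : GamQ p (n + 1)) (x : (layer (n + 1)).V),
    (down n).onV (g • x) = trans p n g • (down n).onV x
  down_smulE : ∀ n (g : GamQ p (n + 1)) (e : (layer (n + 1)).E),
    (down n).onE (g • e) = trans p n g • (down n).onE e
  free : ∀ n (g : GamQ p n) (e : (layer n).E), g • e = e → g = 1
  surjV : ∀ n, Function.Surjective (toBase n).onV
  surjE : ∀ n, Function.Surjective (toBase n).onE
  fibreV : ∀ n (x y : (layer n).V), (toBase n).onV x = (toBase n).onV y ↔ ∃ g : GamQ p n, g • x = y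
  fibreE : ∀ n (e f : (layer n).E), (toBase n).onE e = (toBase n).onE f ↔ ∃ g : GamQ p n, g • e = f
  down_surjV : ∀ n, Function.Surjective (down n).onV
  down_surjE : ∀ n, Function.Surjective (down n).onE
  down_fibreV : ∀ n (x y : (layer (n + 1)).V),
    (down n).onV x = (down n).onV y ↔ ∃ g ∈ (trans p n).ker, g • x = y
  down_fibreE : ∀ n (e f : (layer (n + 1)).E),
    (down n).onE e = (down n).onE f ↔ ∃ g ∈ (trans p n).ker, g • e = f

namespace ZpCovering

variable {p} {X : SerreGraph}

/-- `X_∞ / X` is a covering of connected graphs: every `X_n` is connected. -/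
def IsConnected (C : ZpCovering p X) : Prop := ∀ n, (C.layer n).IsConnected

/-- `λ(X_∞/X) = l` and `μ(X_∞/X) = m`: for some integer `ν` one has
`ord_p(κ_{X_n}) = l * n + m * p ^ n + ν` for all sufficiently large `n`. -/
def HasIwasawaInvariants (C : ZpCovering p X) (l m : ℕ) : Prop :=
  ∃ nu : ℤ, ∀ᶠ n : ℕ in Filter.atTop,
    (padicValNat p (C.layer n).kappa : ℤ) = l * n + m * (p : ℤ) ^ n + nu

/-- The invariants are determined by the covering. -/
theorem HasIwasawaInvariants.unique {C : ZpCovering p X} {l m l' m' : ℕ}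
    (h : C.HasIwasawaInvariants l m) (h' : C.HasIwasawaInvariants l' m') : l = l' ∧ m = m' := by
  obtain ⟨nu, h⟩ := h
  obtain ⟨nu', h'⟩ := h'
  obtain ⟨N, hN⟩ := Filter.eventually_atTop.1 (h.and h')
  have e0 := hN N le_rfl
  have e1 := hN (N + 1) (by omega)
  have e2 := hN (N + 2) (by omega)
  have f0 := e0.1.symm.trans e0.2
  have f1 := e1.1.symm.trans e1.2
  have f2 := e2.1.symm.trans e2.2
  have hp : (2 : ℤ) ≤ p := by exact_mod_cast (Fact.out : p.Prime).two_le
  have hP : (0 : ℤ) < (p : ℤ) ^ N := by positivity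
  push_cast at f1 f2
  rw [pow_succ] at f1
  rw [pow_add] at f2
  have key : ((m : ℤ) - m') * ((p : ℤ) ^ N * ((p : ℤ) - 1) ^ 2) = 0 := by
    linear_combination f2 - 2 * f1 + f0
  have hpos : (p : ℤ) ^ N * ((p : ℤ) - 1) ^ 2 ≠ 0 := by
    have : (p : ℤ) - 1 ≠ 0 := by omega
    positivity
  have hm : (m : ℤ) = m' := by
    rcases mul_eq_zero.1 key with h | h
    · omega
    · exact absurd h hpos
  refine ⟨?_, by exact_mod_cast hm⟩
  rw [hm] at f0 f1
  have : (l : ℤ) = l' := by linear_combination f1 - f0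
  exact_mod_cast this

end ZpCovering

variable {p} {X : SerreGraph}

/-- `I_{v,n}`: the image of `I_v` in `Γ_n`. -/
noncomputable abbrev inertia (I : X.V → Subgroup (Gam p)) (n : ℕ) (v : X.V) :
    Subgroup (GamQ p n) := (I v).map (proj p n)

theorem inertia_succ (I : X.V → Subgroup (Gam p)) (n : ℕ) (v : X.V) :
    inertia I n v = (inertia I (n + 1) v).map (trans p n) := by
  rw [inertia, inertia, Subgroup.map_map, trans_comp]

/-- `I_{v,n+1}` maps into `I_{v,n}`. -/
theorem inertia_le (I : X.V → Subgroup (Gam p)) (n : ℕ) (v : X.V) :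
    inertia I (n + 1) v ≤ (inertia I n v).comap (trans p n) := by
  rw [← Subgroup.map_le_iff_le_comap, ← inertia_succ]

/-- The derived graph `X_n` of a voltage assignment `α : 𝔼_X → Γ` and a family `I = (I_v)_v` of
subgroups of `Γ`: the derived graph for the images of `α` and `I` in `Γ_n`. -/
noncomputable def derivedGraph (α : X.Voltage (Gam p)) (I : X.V → Subgroup (Gam p)) (n : ℕ) :
    SerreGraph :=
  SerreGraph.derived (α.map (proj p n)) (inertia I n)

/-- The `ℤ_p`-covering of `X` formed by the derived graphs, with the maps induced by the projections
`Γ_{n+1} → Γ_n` and the translation action of `Γ_n`. -/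
noncomputable def derivedCovering (α : X.Voltage (Gam p)) (I : X.V → Subgroup (Gam p)) :
    ZpCovering p X where
  layer := derivedGraph α I
  toBase := fun n => SerreGraph.derivedToBase (α.map (proj p n)) (inertia I n)
  down := fun n => SerreGraph.derivedMap (α.map (proj p (n + 1))) (inertia I (n + 1))
    (α.map (proj p n)) (inertia I n) (trans p n) (fun e => trans_proj p n (α.toFun e))
    (inertia_le I n)
  toBase_downV := fun _ => SerreGraph.derivedMap_toBaseV _ _ _ _ _ _ _
  toBase_downE := fun _ => SerreGraph.derivedMap_toBaseE _ _ _ _ _ _ _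
  actV := fun n => SerreGraph.derivedActV (α.map (proj p n)) (inertia I n)
  actE := fun n => SerreGraph.derivedActE (α.map (proj p n)) (inertia I n)
  smul_s := fun _ => SerreGraph.derived_smul_s _ _
  smul_t := fun _ => SerreGraph.derived_smul_t _ _
  smul_bar := fun _ => SerreGraph.derived_smul_bar _ _
  down_smulV := fun _ => SerreGraph.derivedMap_smulV _ _ _ _ _ _ _
  down_smulE := fun _ => SerreGraph.derivedMap_smulE _ _ _ _ _ _ _
  free := fun _ => SerreGraph.derived_free _ _
  surjV := fun _ => SerreGraph.derived_surjV _ _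
  surjE := fun _ => SerreGraph.derived_surjE _ _
  fibreV := fun _ => SerreGraph.derived_fibreV _ _
  fibreE := fun _ => SerreGraph.derived_fibreE _ _
  down_surjV := fun n => SerreGraph.derivedMap_surjV _ _ _ _ _ _ _ (trans_surjective p n)
  down_surjE := fun n => SerreGraph.derivedMap_surjE _ _ _ _ _ _ _ (trans_surjective p n)
  down_fibreV := fun n => SerreGraph.derivedMap_fibreV _ _ _ _ _ _ _ (inertia_succ I n)
  down_fibreE := fun _ => SerreGraph.derivedMap_fibreE _ _ _ _ _ _ _

end ZpTower

/-! Let the unramified vertex carry loops with integer voltages `a`, for `a` in a list `L`, join it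
by `c` edges of trivial voltage to the totally ramified vertex, and repeat every edge `q = p^m`
times. In the `n`-th layer the ramified vertex has a single preimage, and the other vertices form
`ℤ/p^n`. With that single vertex as root, the reduced Laplacian is a circulant, so the matrix-tree
theorem (`SerreGraph.kappa_eq_det`) and Fourier diagonalisation (`det_circulantLaplacian`) express
the number of spanning trees as `q^(p^n) * ∏ f(u)` over all `u` with `u^(p^n) = 1`, where `f(u) = c
+ ∑ (2 - u^a - u^(-a))`. The factor `q^(p^n)` accounts for `μ = m`.

For `λ = 2r`, the data `c` and `L` are chosen with `f(u) ≡ (2 - u - u⁻¹)^r` modulo `p`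
(`exists_list_add_sum_loopValue`). Up to a unit the right side is `(1 - u)^(2r)`. If `u` has order
`p^k` with `φ(p^k) > 2r`, then `p` is divisible by a higher power of `1 - u`, so `f(u)` is `(1 -
u)^(2r)` times an element prime to `p`. As `∏ (1 - u) = p` over the primitive `p^k`-th roots of
unity, every large layer adds exactly `2r` to the valuation besides the `μ`-term
(`exists_padicValNat_eq`). The computation takes place in the ring of all algebraic integers; no
prime above `p` is needed, only that `p` is not a unit there. -/

/-! ### Determinants of functional digraphs -/

section Digraph

variable {ι : Type}

/-- The functional digraph `i ↦ τ i` leads from every vertex to the root `none`. -/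
def IsRooted (τ : ι → Option ι) : Prop :=
  ∃ d : Option ι → ℕ, ∀ i, d (τ i) < d (some i)

/-- The number of steps needed to reach `none` is a decreasing height function. -/
theorem isRooted_of_forall_iterate (τ : ι → Option ι)
    (h : ∀ i, ∃ k, (fun x : Option ι => x.bind τ)^[k] (some i) = none) : IsRooted τ := by
  classical
  have h' : ∀ x : Option ι, ∃ k, (fun x : Option ι => x.bind τ)^[k] x = none := by
    rintro (_ | i)
    · exact ⟨0, rfl⟩
    · exact h i
  refine ⟨fun x => Nat.find (h' x), fun i => ?_⟩
  have hs := Nat.find_spec (h' (some i))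
  rcases hk : Nat.find (h' (some i)) with _ | k
  · rw [hk] at hs
    cases hs
  · rw [hk, Function.iterate_succ_apply] at hs
    have := Nat.find_min' (h' (τ i)) hs
    simp only [hk]
    omega

open scoped Classical in
/-- `1 - A`, where `A` is the adjacency matrix of the functional digraph `i ↦ τ i` with the root
removed. -/
noncomputable def rootedMatrix (τ : ι → Option ι) : Matrix ι ι ℤ :=
  Matrix.of fun i j => (if i = j then 1 else 0) - (if τ i = some j then 1 else 0)

-- Ordered by height, the matrix is triangular; no arrow joins two vertices of equal height, so the
-- diagonal blocks are identities.
open scoped Classical in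
theorem det_rootedMatrix_of_isRooted [Fintype ι] {τ : ι → Option ι} (h : IsRooted τ) :
    (rootedMatrix τ).det = 1 := by
  obtain ⟨d, hd⟩ := h
  have hτ : ∀ i j, d (some i) ≤ d (some j) → τ i ≠ some j := fun i j hij e => by
    have := hd i
    rw [e] at this
    omega
  have hb : (rootedMatrix τ).BlockTriangular fun i => OrderDual.toDual (d (some i)) := by
    intro i j hij
    have hij : d (some i) < d (some j) := hij
    have : i ≠ j := by
      rintro rfl
      omega
    simp [rootedMatrix, this, hτ i j hij.le]
  rw [hb.det]
  refine Finset.prod_eq_one fun a _ => ?_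
  have : (rootedMatrix τ).toSquareBlock (fun i => OrderDual.toDual (d (some i))) a = 1 := by
    ext ⟨i, hi⟩ ⟨j, hj⟩
    have hij : d (some i) ≤ d (some j) := le_of_eq (OrderDual.toDual.injective (hi.trans hj.symm))
    simp [rootedMatrix, Matrix.toSquareBlock_def, hτ i j hij, Matrix.one_apply]
  rw [this, Matrix.det_one]

-- The indicator of the vertices that never reach the root is constant along arrows, hence a nonzero
-- kernel vector.
open scoped Classical in
theorem det_rootedMatrix_of_not_isRooted [Fintype ι] {τ : ι → Option ι} (h : ¬ IsRooted τ) :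
    (rootedMatrix τ).det = 0 := by
  have h' := mt (isRooted_of_forall_iterate τ) h
  set P : Option ι → Prop := fun x => ∃ k, (fun x : Option ι => x.bind τ)^[k] x = none with hP
  have hstep : ∀ i, P (τ i) ↔ P (some i) := by
    intro i
    constructor
    · rintro ⟨k, hk⟩
      exact ⟨k + 1, by rw [Function.iterate_succ_apply]; exact hk⟩
    · rintro ⟨_ | k, hk⟩
      · cases hk
      · exact ⟨k, by rw [Function.iterate_succ_apply] at hk; exact hk⟩
  have hnone : P none := ⟨0, rfl⟩
  push Not at h'
  obtain ⟨i₀, hi₀⟩ := h'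
  have hi₀' : ¬ P (some i₀) := fun ⟨k, hk⟩ => hi₀ k hk
  rw [← Matrix.exists_mulVec_eq_zero_iff]
  refine ⟨fun i => if P (some i) then 0 else 1, fun h0 => ?_, ?_⟩
  · simpa [hi₀'] using congrFun h0 i₀
  · ext i
    simp only [Matrix.mulVec, dotProduct, rootedMatrix, Matrix.of_apply, sub_mul, ite_mul, one_mul,
      zero_mul, Finset.sum_sub_distrib, Finset.sum_ite_eq, Finset.mem_univ, if_true,
      Pi.zero_apply, ← hstep i]
    rcases hτ : τ i with _ | j
    · simp [hnone]
    · simp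

end Digraph

/-! ### The matrix-tree theorem -/

namespace SerreGraph

variable (X : SerreGraph)

theorem Joined.mono {X : SerreGraph} {F F' : Set X.E} (hF : F ⊆ F') {u v : X.V}
    (huv : X.Joined F u v) : X.Joined F' u v :=
  Relation.ReflTransGen.mono (fun _ _ ⟨a, ha, h⟩ => ⟨a, hF ha, h⟩) _ _ huv

theorem Joined.symm {X : SerreGraph} {F : Set X.E} (hF : ∀ a ∈ F, X.bar a ∈ F) {u v : X.V}
    (huv : X.Joined F u v) : X.Joined F v u := by
  induction huv with
  | refl => exact .refl
  | tail _ h ih =>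
    obtain ⟨a, ha, rfl, rfl⟩ := h
    exact ih.head ⟨X.bar a, hF a ha, X.s_bar a, X.t_bar a⟩

variable {X} {ι : Type} (e : Option ι ≃ X.V)

/-- The choice of an outgoing edge at every vertex other than the root `e none`. -/
abbrev OutChoice : Type := ∀ i : ι, {a : X.E // X.s a = e (some i)}

namespace OutChoice

variable {e}

/-- The functional digraph of a choice of outgoing edges. -/
def succ (r : OutChoice e) (i : ι) : Option ι := e.symm (X.t (r i))

/-- The set of the chosen edges and their opposites. -/
def edges (r : OutChoice e) : Set X.E := {a | ∃ i, a = r i ∨ a = X.bar (r i)}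

theorem t_eq (r : OutChoice e) (i : ι) : X.t (r i) = e (r.succ i) :=
  (e.apply_symm_apply _).symm

theorem bar_mem_edges (r : OutChoice e) : ∀ a ∈ r.edges, X.bar a ∈ r.edges := by
  rintro _ ⟨i, rfl | rfl⟩
  · exact ⟨i, Or.inr rfl⟩
  · exact ⟨i, Or.inl (X.bar_bar _)⟩

theorem joined_root (r : OutChoice e) (h : IsRooted r.succ) (x : Option ι) :
    X.Joined r.edges (e x) (e none) := by
  obtain ⟨d, hd⟩ := h
  induction hn : d x using Nat.strong_induction_on generalizing x with
  | _ n ih =>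
    rcases x with _ | i
    · exact Relation.ReflTransGen.refl
    · exact Relation.ReflTransGen.head ⟨r i, ⟨i, Or.inl rfl⟩, (r i).2, r.t_eq i⟩
        (ih _ (hn ▸ hd i) _ rfl)

theorem connectedBy_edges (r : OutChoice e) (h : IsRooted r.succ) : X.ConnectedBy r.edges := by
  refine ⟨⟨e none⟩, fun u v => ?_⟩
  have hu := r.joined_root h (e.symm u)
  have hv := r.joined_root h (e.symm v)
  rw [e.apply_symm_apply] at hu hv
  exact hu.trans (hv.symm r.bar_mem_edges)

/-- Removing the chosen edge at `i` separates the vertices below `i` from the others. -/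
theorem joined_diff_iff (r : OutChoice e) (i : ι) {u v : X.V}
    (huv : X.Joined (r.edges \ {↑(r i), X.bar (r i)}) u v) :
    Relation.ReflTransGen (fun x y => ∃ j, x = some j ∧ y = r.succ j) (e.symm u) (some i) ↔
      Relation.ReflTransGen (fun x y => ∃ j, x = some j ∧ y = r.succ j) (e.symm v) (some i) := by
  have key : ∀ j, j ≠ i →
      (Relation.ReflTransGen (fun x y => ∃ j, x = some j ∧ y = r.succ j) (some j) (some i) ↔
      Relation.ReflTransGen (fun x y => ∃ j, x = some j ∧ y = r.succ j) (r.succ j) (some i)) := by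
    intro j hj
    constructor
    · intro h
      rcases h.cases_head with h | ⟨y, ⟨k, hk, rfl⟩, h⟩
      · exact absurd (Option.some.inj h) hj
      · obtain rfl := Option.some.inj hk
        exact h
    · exact fun h => h.head ⟨j, rfl, rfl⟩
  induction huv with
  | refl => rfl
  | tail _ h ih =>
    obtain ⟨a, ⟨⟨j, ha⟩, hn⟩, rfl, rfl⟩ := h
    refine ih.trans ?_
    have hj : j ≠ i := by
      rintro rfl
      exact hn ha
    have hs : e.symm (X.s (r j)) = some j := by rw [(r j).2, e.symm_apply_apply]
    rcases ha with rfl | rfl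
    · rw [hs]
      exact key j hj
    · rw [X.s_bar, X.t_bar, hs]
      exact (key j hj).symm

/-- For acyclicity: the source of the chosen edge at `i` leads to `i`, while its target has smaller
height and does not. By `joined_diff_iff` no walk avoiding that edge joins them. -/
theorem isSpanningTree_edges (r : OutChoice e) (h : IsRooted r.succ) :
    X.IsSpanningTree r.edges := by
  refine ⟨r.bar_mem_edges, r.connectedBy_edges h, ?_⟩
  obtain ⟨d, hd⟩ := h
  have hd' : ∀ x y, Relation.ReflTransGen (fun x y => ∃ j, x = some j ∧ y = r.succ j) x y →
      d y ≤ d x := by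
    intro x y hxy
    induction hxy with
    | refl => rfl
    | tail _ h ih =>
      obtain ⟨j, rfl, rfl⟩ := h
      exact (hd j).le.trans ih
  have hsep : ∀ i u v, X.Joined (r.edges \ {↑(r i), X.bar (r i)}) u v →
      ¬ (u = e (some i) ∧ v = e (r.succ i)) ∧ ¬ (u = e (r.succ i) ∧ v = e (some i)) := by
    intro i u v huv
    have := r.joined_diff_iff i huv
    have hlt : ¬ Relation.ReflTransGen (fun x y => ∃ j, x = some j ∧ y = r.succ j)
        (r.succ i) (some i) := fun h => absurd (hd' _ _ h) (not_le.2 (hd i))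
    constructor
    · rintro ⟨rfl, rfl⟩
      rw [e.symm_apply_apply, e.symm_apply_apply] at this
      exact hlt (this.1 .refl)
    · rintro ⟨rfl, rfl⟩
      rw [e.symm_apply_apply, e.symm_apply_apply] at this
      exact hlt (this.2 .refl)
  rintro _ ⟨i, rfl | rfl⟩ hj
  · exact (hsep i _ _ hj).1 ⟨(r i).2, r.t_eq i⟩
  · rw [X.bar_bar, Set.pair_comm] at hj
    exact (hsep i _ _ hj).2 ⟨(X.s_bar _).trans (r.t_eq i), (X.t_bar _).trans (r i).2⟩

/-- Induction on the height for `r`. If the chosen edge at `i` were the reverse of the edge that `q`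
chooses at `j`, then `r` and `q` would agree at the lower vertex `j`, and `r` would run from `i` to
`j` and back. -/
theorem edges_injOn : Set.InjOn (edges (e := e)) {r | IsRooted r.succ} := by
  rintro r ⟨d, hd⟩ q - hrq
  suffices ∀ n i, d (some i) = n → r i = q i from funext fun i => this _ i rfl
  intro n
  induction n using Nat.strong_induction_on with
  | _ n ih =>
    intro i hi
    have hmem : (r i : X.E) ∈ q.edges := hrq ▸ ⟨i, Or.inl rfl⟩
    obtain ⟨j, hj | hj⟩ := hmem
    · have : some i = some j := e.injective (by rw [← (r i).2, ← (q j).2, hj])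
      obtain rfl := Option.some.inj this
      exact Subtype.ext hj
    · have hsj : r.succ i = some j := by
        rw [succ, hj, X.t_bar, (q j).2, e.symm_apply_apply]
      have hlt := hd i
      rw [hsj] at hlt
      have hq := ih _ (hi ▸ hlt) j rfl
      have hsi : r.succ j = some i := by
        rw [succ, hq, ← X.s_bar, ← hj, (r i).2, e.symm_apply_apply]
      have := hd j
      rw [hsi] at this
      omega

/-- Every spanning tree is obtained by orienting its edges towards the root. -/
theorem exists_edges_eq {F : Set X.E} (hF : X.IsSpanningTree F) :
    ∃ r : OutChoice e, IsRooted r.succ ∧ r.edges = F := by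
  classical
  -- Walks are given an explicit length, so that `Nat.find` yields the distance to the root; `r`
  -- then takes the first edge of a shortest walk.
  have hlen : ∀ v, ∃ n, ∃ f : ℕ → X.V, f 0 = v ∧ f n = e none ∧
      ∀ k < n, ∃ a ∈ F, X.s a = f k ∧ X.t a = f (k + 1) := by
    intro v
    have h := hF.connected.2 v (e none)
    unfold Joined at h
    induction h using Relation.ReflTransGen.head_induction_on with
    | refl => exact ⟨0, fun _ => e none, rfl, rfl, by simp⟩
    | @head u w h _ ih =>
      obtain ⟨n, f, h0, hn, hf⟩ := ih
      refine ⟨n + 1, fun k => Nat.casesOn k u f, rfl, hn, ?_⟩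
      rintro (_ | k) hk
      · obtain ⟨a, ha, h1, h2⟩ := h
        exact ⟨a, ha, h1, h2.trans h0.symm⟩
      · exact hf k (by omega)
  have hstep : ∀ i, ∃ a ∈ F, X.s a = e (some i) ∧
      Nat.find (hlen (X.t a)) < Nat.find (hlen (e (some i))) := by
    intro i
    obtain ⟨f, h0, hn, hf⟩ := Nat.find_spec (hlen (e (some i)))
    set n := Nat.find (hlen (e (some i))) with hndef
    clear_value n
    obtain _ | n := n
    · exact absurd (e.injective (h0.symm.trans hn)) (by simp)
    · obtain ⟨a, ha, h1, h2⟩ := hf 0 (by omega)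
      refine ⟨a, ha, h1.trans h0, Nat.lt_succ_of_le (Nat.find_min' _ ?_)⟩
      exact ⟨fun k => f (k + 1), h2.symm, hn, fun k hk => hf (k + 1) (by omega)⟩
  choose a haF has hat using hstep
  let r : OutChoice e := fun i => ⟨a i, has i⟩
  have hr : IsRooted r.succ :=
    ⟨fun x => Nat.find (hlen (e x)), fun i => by
      have h2 : e (r.succ i) = X.t (a i) := e.apply_symm_apply _
      simpa only [h2] using hat i⟩
  have hsub : r.edges ⊆ F := by
    rintro _ ⟨i, rfl | rfl⟩
    · exact haF i
    · exact hF.bar_mem _ (haF i)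
  refine ⟨r, hr, hsub.antisymm fun b hb => ?_⟩
  -- The chosen edges already connect everything, so a further edge `b` of `F` would close a
  -- circuit.
  by_contra hbr
  have hsub' : r.edges ⊆ F \ {b, X.bar b} := by
    refine fun c hc => ⟨hsub hc, ?_⟩
    rintro (rfl | rfl)
    · exact hbr hc
    · exact hbr (X.bar_bar b ▸ r.bar_mem_edges _ hc)
  exact hF.acyclic b hb (((r.connectedBy_edges hr).2 _ _).mono hsub')

end OutChoice

open scoped Classical in
/-- The Laplacian matrix with the row and the column of the root `e none` removed. -/
noncomputable def reducedLaplacian [Fintype X.E] (e : Option ι ≃ X.V) : Matrix ι ι ℤ :=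
  Matrix.of fun i j => ∑ a : X.E, if X.s a = e (some i) then
    (if i = j then 1 else 0) - (if X.t a = e (some j) then 1 else 0) else 0

open scoped Classical in
/-- **Matrix-tree theorem.** -/
theorem kappa_eq_det [Fintype ι] [Fintype X.E] (e : Option ι ≃ X.V) :
    (X.kappa : ℤ) = (reducedLaplacian e).det := by
  -- Row `i` is a sum over the edges leaving `i`, so multilinearity expands the determinant over all
  -- choices of outgoing edges; each choice contributes 1 or 0.
  have hL : reducedLaplacian e = fun i => ∑ a : {a : X.E // X.s a = e (some i)},
      fun j => (if i = j then 1 else 0) - (if X.t a = e (some j) then 1 else 0) := by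
    ext i j
    rw [Finset.sum_apply, reducedLaplacian, Matrix.of_apply, ← Finset.sum_filter]
    exact Finset.sum_subtype _ (by simp) _
  have hdet : (reducedLaplacian e).det =
      ∑ r : OutChoice e, (rootedMatrix r.succ).det := by
    rw [hL]
    refine ((Matrix.detRowAlternating (R := ℤ) (n := ι)).toMultilinearMap.map_sum
      (fun i (a : {a : X.E // X.s a = e (some i)}) j =>
        (if i = j then 1 else 0) - (if X.t a = e (some j) then 1 else 0))).trans ?_
    refine Finset.sum_congr rfl fun r _ => ?_
    refine congrArg Matrix.det ?_
    ext i j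
    simp [rootedMatrix, OutChoice.succ, Equiv.symm_apply_eq]
  have hdet' : (reducedLaplacian e).det = Fintype.card {r : OutChoice e // IsRooted r.succ} := by
    rw [hdet, Fintype.card_subtype, Finset.card_filter]
    push_cast
    refine Finset.sum_congr rfl fun r _ => ?_
    split_ifs with h
    · exact det_rootedMatrix_of_isRooted h
    · exact det_rootedMatrix_of_not_isRooted h
  rw [hdet', ← Nat.card_eq_fintype_card, kappa]
  have himg : {F | X.IsSpanningTree F} = OutChoice.edges (e := e) '' {r | IsRooted r.succ} := by
    ext F
    constructor
    · intro hF
      obtain ⟨r, hr, rfl⟩ := OutChoice.exists_edges_eq (e := e) hF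
      exact ⟨r, hr, rfl⟩
    · rintro ⟨r, hr, rfl⟩
      exact r.isSpanningTree_edges hr
  rw [himg, OutChoice.edges_injOn.ncard_image]
  rfl

end SerreGraph

/-! ### Sums of loop values modulo `p` -/

section LoopValue

variable {O : Type*} [CommRing O]

/-- The value `2 - u ^ a - u ^ (-a)` of the Laplacian of the Cayley graph with the single pair of
generators `a`, `-a` at the character with value `u` at `1`. -/
def loopValue (a : ℤ) (u : Oˣ) : O := 2 - ↑(u ^ a) - ↑(u ^ (-a))

theorem loopValue_mul (a b : ℤ) (u : Oˣ) :
    loopValue a u * loopValue b u =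
      2 * loopValue a u + 2 * loopValue b u - loopValue (a + b) u - loopValue (a - b) u := by
  simp only [loopValue, sub_eq_add_neg a b, neg_add, neg_neg, zpow_add, Units.val_mul]
  ring

/-- The square is what makes the resulting `λ` even. -/
theorem loopValue_one (u : Oˣ) : loopValue 1 u = -(1 - (u : O)) ^ 2 * ↑u⁻¹ := by
  have := u.mul_inv
  simp only [loopValue, zpow_one, zpow_neg]
  linear_combination ((u : O) - 2) * this

/-- Modulo `p`, the power `(2 - u - u⁻¹) ^ r` is a sum of values `2 - u ^ a - u ^ (-a)`. -/
theorem exists_list_sum_loopValue_eq_pow_succ (p : ℕ) (hp : 0 < p) (r : ℕ) :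
    ∃ (l : List ℤ) (h : Oˣ → O), ∀ u,
      (l.map (loopValue · u)).sum = loopValue 1 u ^ (r + 1) + p * h u := by
  -- Only sums without signs are allowed, since loops occur with nonnegative multiplicity. Modulo
  -- `p` this is no restriction.
  set P : (Oˣ → O) → Prop := fun x => ∃ (l : List ℤ) (h : Oˣ → O), ∀ u,
    (l.map (loopValue · u)).sum = x u + p * h u with hP
  have hbase : ∀ a, P (loopValue a) := fun a => ⟨[a], 0, fun u => by simp⟩
  have hadd : ∀ x y, P x → P y → P (x + y) := by
    rintro x y ⟨l, h, hl⟩ ⟨l', h', hl'⟩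
    exact ⟨l ++ l', h + h', fun u => by
      simp only [List.map_append, List.sum_append, hl, hl', Pi.add_apply]; ring⟩
  have hnsmul : ∀ (x : Oˣ → O) (n : ℕ), P x → P (n • x) := by
    intro x n hx
    induction n with
    | zero => exact ⟨[], 0, fun u => by simp⟩
    | succ n ih => rw [succ_nsmul]; exact hadd _ _ ih hx
  have hmod : ∀ x h, P x → P (x + (p : Oˣ → O) * h) := by
    rintro x h ⟨l, k, hl⟩
    exact ⟨l, k - h, fun u => by
      simp only [hl, Pi.add_apply, Pi.mul_apply, Pi.natCast_apply, Pi.sub_apply]; ring⟩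
  have hneg : ∀ x, P x → P (-x) := by
    intro x hx
    -- `-x = (p - 1) x + p (-x)`.
    have := hmod _ (-x) (hnsmul x (p - 1) hx)
    convert this using 1
    obtain ⟨q, rfl⟩ := Nat.exists_eq_succ_of_ne_zero hp.ne'
    simp only [nsmul_eq_mul, Nat.succ_eq_add_one, Nat.add_sub_cancel]
    push_cast
    ring
  have hlist : ∀ l : List ℤ, P fun u => (l.map (loopValue · u)).sum * loopValue 1 u := by
    intro l
    induction l with
    | nil => exact ⟨[], 0, fun u => by simp⟩
    | cons a l ih =>
      have h1 := hadd _ _ (hadd _ _ (hnsmul _ 2 (hbase a)) (hnsmul _ 2 (hbase 1)))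
        (hadd _ _ (hneg _ (hbase (a + 1))) (hneg _ (hbase (a - 1))))
      convert hadd _ _ h1 ih using 1
      ext u
      simp only [List.map_cons, List.sum_cons, add_mul, loopValue_mul, Pi.add_apply, Pi.neg_apply,
        two_smul]
      ring
  suffices P fun u => loopValue 1 u ^ (r + 1) from this
  induction r with
  | zero => simpa using hbase 1
  | succ r ih =>
    obtain ⟨l, h, hl⟩ := ih
    convert hmod _ (fun u => -h u * loopValue 1 u) (hlist l) using 1
    ext u
    simp only [hl, Pi.add_apply, Pi.mul_apply, Pi.natCast_apply]
    ring

/-- The constant `c` counts edges to the root and must be positive for connectedness. For `r = 0`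
the value 1 is the required power itself; otherwise `c = p` is absorbed in the multiple of `p`. -/
theorem exists_list_add_sum_loopValue (p : ℕ) (hp : 0 < p) (r : ℕ) :
    ∃ (c : ℕ) (l : List ℤ) (h : Oˣ → O), 0 < c ∧ ∀ u,
      c + (l.map (loopValue · u)).sum = loopValue 1 u ^ r + p * h u := by
  obtain _ | r := r
  · exact ⟨1, [], 0, one_pos, fun u => by simp⟩
  · obtain ⟨l, h, hl⟩ := exists_list_sum_loopValue_eq_pow_succ (O := O) p hp r
    exact ⟨p, l, h + 1, hp, fun u => by rw [hl, Pi.add_apply, Pi.one_apply]; ring⟩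

end LoopValue

/-! ### Valuations at roots of unity of `p`-power order -/

section Valuation

/-- Expand `1 = ((1 - w) + w)^(p^k)` modulo `p`. Consequently an element coprime to `1 - w` is
coprime to `p`. -/
theorem dvd_one_sub_pow {O : Type*} [CommRing O] {p : ℕ} [hp : Fact p.Prime] {w : O}
     {k : ℕ} (hw : w ^ p ^ k = 1) : (p : O) ∣ (1 - w) ^ p ^ k := by
  obtain ⟨r, hr⟩ := exists_add_pow_prime_pow_eq hp.out (1 - w) w k
  rw [sub_add_cancel, one_pow, hw] at hr
  exact ⟨-((1 - w) * w * r), by linear_combination -hr⟩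

variable {O : Type*} [CommRing O] [IsDomain O] {p : ℕ} [hp : Fact p.Prime]

/-- Separates the exponents giving roots of unity of the previous layer from those giving primitive
ones. -/
theorem prod_range_prime_pow_succ {M : Type*} [CommMonoid M] (g : ℕ → M) (k : ℕ) :
    ∏ j ∈ Finset.range (p ^ (k + 1)), g j = (∏ j ∈ Finset.range (p ^ k), g (p * j)) *
      ∏ j ∈ Finset.range (p ^ (k + 1)) with (p ^ (k + 1)).Coprime j, g j := by
  rw [← Finset.prod_filter_not_mul_prod_filter _ (fun j => (p ^ (k + 1)).Coprime j)]
  congr 1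
  symm
  refine Finset.prod_bij (fun j _ => p * j) ?_ ?_ ?_ fun _ _ => rfl
  · intro j hj
    rw [Finset.mem_range] at hj
    rw [Finset.mem_filter, Finset.mem_range, Nat.coprime_pow_left_iff (Nat.succ_pos k),
      hp.out.coprime_iff_not_dvd, pow_succ']
    exact ⟨Nat.mul_lt_mul_of_pos_left hj hp.out.pos, fun h => h (dvd_mul_right _ _)⟩
  · intro i _ j _ h
    exact Nat.eq_of_mul_eq_mul_left hp.out.pos h
  · intro j hj
    rw [Finset.mem_filter, Finset.mem_range, Nat.coprime_pow_left_iff (Nat.succ_pos k),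
      hp.out.coprime_iff_not_dvd, not_not, pow_succ'] at hj
    obtain ⟨hj, i, rfl⟩ := hj
    exact ⟨i, Finset.mem_range.2 (Nat.lt_of_mul_lt_mul_left hj), rfl⟩

/-- Both sides are the value at 1 of the cyclotomic polynomial of index `p^(k+1)`. -/
theorem prod_one_sub_primitive_pow {w : O} {k : ℕ} (hw : IsPrimitiveRoot w (p ^ (k + 1))) :
    ∏ j ∈ Finset.range (p ^ (k + 1)) with (p ^ (k + 1)).Coprime j, (1 - w ^ j) = p := by
  have h1 := congrArg (Polynomial.eval 1) (Polynomial.cyclotomic_eq_prod_X_sub_primitiveRoots hw)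
  rw [Polynomial.eval_one_cyclotomic_prime_pow, Polynomial.eval_prod] at h1
  rw [h1]
  refine Finset.prod_bij (fun j _ => w ^ j) ?_ ?_ ?_ (by simp)
  · intro j hj
    rw [Finset.mem_filter] at hj
    exact (mem_primitiveRoots (pow_pos hp.out.pos _)).2 (hw.pow_of_coprime _ hj.2.symm)
  · intro i hi j hj h
    rw [Finset.mem_filter, Finset.mem_range] at hi hj
    exact hw.pow_inj hi.1 hj.1 h
  · intro z hz
    obtain ⟨i, hi, hc, rfl⟩ := hw.isPrimitiveRoot_iff.1
      ((mem_primitiveRoots (pow_pos hp.out.pos _)).1 hz)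
    exact ⟨i, Finset.mem_filter.2 ⟨Finset.mem_range.2 hi, hc.symm⟩, rfl⟩

/-- `(1 - w) ^ φ(p ^ k)` divides `p` for a primitive `p ^ k`-th root of unity `w`. -/
theorem one_sub_pow_totient_dvd {w : O} {k : ℕ} (hw : IsPrimitiveRoot w (p ^ (k + 1))) :
    (1 - w) ^ (p ^ (k + 1)).totient ∣ (p : O) := by
  rw [← prod_one_sub_primitive_pow hw, Nat.totient, ← Finset.prod_const]
  refine Finset.prod_dvd_prod_of_dvd _ _ fun j _ => ?_
  simpa using sub_dvd_pow_sub_pow (1 : O) w j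

/-- The order of vanishing modulo `p` determines the valuation at roots of unity of large order. -/
theorem exists_isCoprime_of_eq_loopValue_pow_add {u : Oˣ} {k r : ℕ} {x y : O}
    (hu : IsPrimitiveRoot (u : O) (p ^ (k + 1))) (hr : 2 * r < (p ^ (k + 1)).totient)
    (hx : x = loopValue 1 u ^ r + p * y) :
    ∃ z, IsCoprime z (p : O) ∧ x = (1 - (u : O)) ^ (2 * r) * z := by
  -- The strict inequality gives `p = (1 - u)^(2r+1) q`: after division by `(1 - u)^(2r)`, the term
  -- `p * y` still contains a factor `1 - u`, so the cofactor is a unit modulo `1 - u`.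
  obtain ⟨q, hq⟩ := (pow_dvd_pow _ hr).trans (one_sub_pow_totient_dvd hu)
  refine ⟨(-↑u⁻¹) ^ r + (1 - (u : O)) * (q * y), ?_, ?_⟩
  · have h1 : IsCoprime ((-↑u⁻¹ : O) ^ r) (1 - (u : O)) :=
      IsCoprime.pow_left (isCoprime_one_left.of_isCoprime_of_dvd_left u⁻¹.isUnit.neg.dvd)
    exact (IsCoprime.pow_right (h1.add_mul_left_left _)).of_isCoprime_of_dvd_right
      (dvd_one_sub_pow hu.pow_eq_one)
  · rw [hx, loopValue_one, pow_mul]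
    rw [Nat.succ_eq_add_one, pow_succ, pow_mul] at hq
    rw [neg_mul_comm, mul_pow]
    linear_combination y * hq

/-- After cancelling powers of `p`, unequal valuations would make `p` divide an element coprime to
it, forcing `p` to be a unit. -/
theorem padicValNat_eq_of_cast_eq_mul [CharZero O] (hpO : ¬ IsUnit (p : O)) {A B : ℕ} (hA : A ≠ 0)
    (hB : B ≠ 0) {z : O} (hz : IsCoprime z (p : O)) (h : (A : O) = B * z) :
    padicValNat p A = padicValNat p B := by
  have hp0 : (p : O) ≠ 0 := Nat.cast_ne_zero.2 hp.out.ne_zero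
  have hcop : ∀ n : ℕ, ¬ p ∣ n → IsCoprime (n : O) (p : O) := fun n hn => by
    have := ((Nat.isCoprime_iff_coprime.2 ((hp.out.coprime_iff_not_dvd.2 hn).symm)).map
      (Int.castRingHom O))
    simpa using this
  have hnd : ∀ (x y : O) (d : ℕ), IsCoprime x (p : O) → x = p ^ (d + 1) * y → False := by
    intro x y d hx hxy
    exact hpO (hx.isUnit_of_dvd' (hxy ▸ (dvd_pow_self _ d.succ_ne_zero).mul_right _) dvd_rfl)
  obtain ⟨a, A, hA', rfl⟩ := Nat.exists_eq_pow_mul_and_not_dvd hA p hp.out.ne_one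
  obtain ⟨b, B, hB', rfl⟩ := Nat.exists_eq_pow_mul_and_not_dvd hB p hp.out.ne_one
  have hval : ∀ n C : ℕ, ¬ p ∣ C → padicValNat p (p ^ n * C) = n := fun n C hC => by
    rw [padicValNat.mul (pow_ne_zero _ hp.out.ne_zero) (by rintro rfl; exact hC (dvd_zero _)),
      padicValNat.prime_pow, padicValNat.eq_zero_of_not_dvd hC, add_zero]
  rw [hval a A hA', hval b B hB']
  push_cast at h
  rcases lt_trichotomy a b with hab | hab | hab
  · obtain ⟨d, rfl⟩ := Nat.exists_eq_add_of_lt hab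
    refine (hnd A (B * z) d (hcop A hA') (mul_left_cancel₀ (pow_ne_zero a hp0) ?_)).elim
    rw [h]
    ring
  · exact hab
  · obtain ⟨d, rfl⟩ := Nat.exists_eq_add_of_lt hab
    refine (hnd (B * z) A d ((hcop B hB').mul_left hz)
      (mul_left_cancel₀ (pow_ne_zero b hp0) ?_)).elim
    rw [← mul_assoc, ← h]
    ring

/-- Iwasawa's formula for the values of a function of the form
`u ↦ (2 - u - u⁻¹) ^ r + p * h u` at the roots of unity of `p`-power order. -/
theorem exists_padicValNat_eq [CharZero O] (hpO : ¬ IsUnit (p : O)) (w : ℕ → Oˣ)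
    (hw : ∀ n, IsPrimitiveRoot (w n : O) (p ^ n)) (hwp : ∀ n, w (n + 1) ^ p = w n)
    (f h : Oˣ → O) (r m : ℕ) (hf : ∀ u, f u = loopValue 1 u ^ r + p * h u)
    (K : ℕ → ℕ) (hK0 : ∀ n, K n ≠ 0)
    (hK : ∀ n, (K n : O) = (p : O) ^ (m * p ^ n) * ∏ j ∈ Finset.range (p ^ n), f (w n ^ j)) :
    ∃ nu : ℤ, ∀ᶠ n : ℕ in Filter.atTop,
      (padicValNat p (K n) : ℤ) = (2 * r : ℕ) * n + m * (p : ℤ) ^ n + nu := by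
  -- The increment from layer `n` to `n + 1` is `m (p^(n+1) - p^n) + 2r`, written without
  -- subtraction. The bound on `n` suffices because `2r ≤ n < p^n ≤ φ(p^(n+1))`.
  have hstep : ∀ n, 2 * r ≤ n → padicValNat p (K (n + 1)) + m * p ^ n =
      padicValNat p (K n) + (m * p ^ (n + 1) + 2 * r) := by
    intro n hn
    have htot : 2 * r < (p ^ (n + 1)).totient := by
      rw [Nat.totient_prime_pow_succ hp.out]
      exact (hn.trans_lt (Nat.lt_pow_self hp.out.one_lt)).trans_le
        (Nat.le_mul_of_pos_right _ (Nat.sub_pos_of_lt hp.out.one_lt))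
    have hprim : ∀ j ∈ (Finset.range (p ^ (n + 1))).filter (p ^ (n + 1)).Coprime,
        ∃ z, IsCoprime z (p : O) ∧ f (w (n + 1) ^ j) = (1 - (w (n + 1) : O) ^ j) ^ (2 * r) * z := by
      intro j hj
      have hj' : IsPrimitiveRoot ((w (n + 1) ^ j : Oˣ) : O) (p ^ (n + 1)) := by
        rw [Units.val_pow_eq_pow_val]
        exact (hw (n + 1)).pow_of_coprime _ (Finset.mem_filter.1 hj).2.symm
      obtain ⟨z, hz, h⟩ := exists_isCoprime_of_eq_loopValue_pow_add hj' htot (hf _)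
      exact ⟨z, hz, by rw [h, Units.val_pow_eq_pow_val]⟩
    choose! z hz hfz using hprim
    have hprod : ∏ j ∈ Finset.range (p ^ (n + 1)), f (w (n + 1) ^ j) =
        (∏ j ∈ Finset.range (p ^ n), f (w n ^ j)) * ((p : O) ^ (2 * r) *
          ∏ j ∈ Finset.range (p ^ (n + 1)) with (p ^ (n + 1)).Coprime j, z j) := by
      rw [prod_range_prime_pow_succ, Finset.prod_congr rfl hfz, Finset.prod_mul_distrib,
        Finset.prod_pow, prod_one_sub_primitive_pow (hw (n + 1))]
      simp only [pow_mul, hwp]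
    have hcast : ((K (n + 1) * p ^ (m * p ^ n) : ℕ) : O) =
        ((K n * p ^ (m * p ^ (n + 1) + 2 * r) : ℕ) : O) *
          ∏ j ∈ Finset.range (p ^ (n + 1)) with (p ^ (n + 1)).Coprime j, z j := by
      push_cast
      rw [hK, hK, hprod]
      ring
    have hppow : ∀ k, p ^ k ≠ 0 := fun k => pow_ne_zero _ hp.out.ne_zero
    have := padicValNat_eq_of_cast_eq_mul hpO (mul_ne_zero (hK0 _) (hppow _))
      (mul_ne_zero (hK0 _) (hppow _)) (IsCoprime.prod_left hz) hcast
    rwa [padicValNat.mul (hK0 _) (hppow _), padicValNat.mul (hK0 _) (hppow _),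
      padicValNat.prime_pow, padicValNat.prime_pow] at this
  -- `ν` is fixed by the formula at `n = 2r`, where the recursion starts.
  refine ⟨padicValNat p (K (2 * r)) - (2 * r : ℕ) * (2 * r : ℕ) - m * (p : ℤ) ^ (2 * r), ?_⟩
  refine Filter.eventually_atTop.2 ⟨2 * r, fun n hn => ?_⟩
  induction n, hn using Nat.le_induction with
  | base => push_cast; ring
  | succ n hn ih =>
    have h1 : (padicValNat p (K (n + 1)) : ℤ) + m * (p : ℤ) ^ n =
        padicValNat p (K n) + (m * (p : ℤ) ^ (n + 1) + 2 * r) := by exact_mod_cast hstep n hn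
    rw [ih] at h1
    push_cast at h1 ⊢
    linear_combination h1

end Valuation

/-! ### Diagonalisation of circulant Laplacians -/

section Circulant

variable (N : ℕ) [NeZero N] (R : Type*) [CommRing R]

/-- The permutation matrix of the translation by `a` on `ℤ/N`. -/
def shiftMatrix (a : ℤ) : Matrix (ZMod N) (ZMod N) R :=
  Matrix.of fun i j => if i + a = j then 1 else 0

/-- The Laplacian of the Cayley multigraph on `ℤ/N` with `q` loops of voltage `a` for each `a` in
`l`, and with `q * c` further edges from each vertex to a removed root. -/
def circulantLaplacian (q c : ℕ) (l : List ℤ) : Matrix (ZMod N) (ZMod N) R :=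
  (q : Matrix (ZMod N) (ZMod N) R) * (c + (l.map fun a => 2 - shiftMatrix N R a -
    shiftMatrix N R (-a)).sum)

variable {R}

theorem map_circulantLaplacian {S : Type*} [CommRing S] (φ : R →+* S) (q c : ℕ) (l : List ℤ) :
    φ.mapMatrix (circulantLaplacian N R q c l) = circulantLaplacian N S q c l := by
  have hs : ∀ a, φ.mapMatrix (shiftMatrix N R a) = shiftMatrix N S a := fun a => by
    ext i j
    simp only [shiftMatrix, RingHom.mapMatrix_apply, Matrix.map_apply, Matrix.of_apply]
    split_ifs <;> simp
  simp only [circulantLaplacian, map_mul, map_natCast, map_add, map_list_sum, List.map_map]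
  congr 4
  ext1 a
  simp only [Function.comp, map_sub, hs, map_ofNat]

variable {N}

/-- The determinant of a circulant Laplacian is the product of its eigenvalues. -/
theorem det_circulantLaplacian {O : Type*} [CommRing O] [IsDomain O] [CharZero O] {w : Oˣ}
    (hw : IsPrimitiveRoot (w : O) N) (q c : ℕ) (l : List ℤ) :
    (circulantLaplacian N O q c l).det = (q : O) ^ N * ∏ j ∈ Finset.range N,
      (c + (l.map (loopValue · (w ^ j))).sum) := by
  classical
  have hwN : w ^ N = 1 := Units.ext (by simpa using hw.pow_eq_one)
  set ψ : AddChar (ZMod N) O := AddChar.zmodChar N hw.pow_eq_one with hψ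
  have hprim : ψ.IsPrimitive := AddChar.zmodChar_primitive_of_primitive_root N hw
  have hψval : ∀ (a : ℤ) (j : ZMod N), ψ (a * j) = ((w ^ j.val) ^ a : Oˣ) := by
    intro a j
    -- The unit-valued version of `ψ` gives meaning to negative exponents `a`.
    set Ψ : AddChar (ZMod N) Oˣ := AddChar.zmodChar N hwN with hΨ
    have h1 : ∀ x, ψ x = (Ψ x : O) := fun x => by
      simp [hψ, hΨ, AddChar.zmodChar_apply]
    rw [h1, ← AddChar.zmodChar_apply hwN, ← hΨ, ← AddChar.map_zsmul_eq_zpow, zsmul_eq_mul]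
  -- The Fourier matrix: its columns are common eigenvectors of all shifts. By orthogonality of
  -- characters its determinant is nonzero, which suffices to cancel it in the domain `O`.
  set F : Matrix (ZMod N) (ZMod N) O := Matrix.of fun i j => ψ (i * j) with hF
  have hFdet : F.det ≠ 0 := by
    have hFF : F * (Matrix.of fun i j => ψ (-(i * j))) = (N : Matrix (ZMod N) (ZMod N) O) := by
      ext i k
      have : ∀ j, ψ (i * j) * ψ (-(j * k)) = ψ (j * (i - k)) := fun j => by
        rw [← AddChar.map_add_eq_mul]
        congr 1
        ring
      simp only [Matrix.mul_apply, hF, Matrix.of_apply, this, AddChar.sum_mulShift _ hprim,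
        ZMod.card, sub_eq_zero, Matrix.natCast_apply]
    have := congrArg Matrix.det hFF
    rw [Matrix.det_mul, ← Matrix.diagonal_natCast, Matrix.det_diagonal, Finset.prod_const] at this
    exact left_ne_zero_of_mul (this ▸ pow_ne_zero _ (Nat.cast_ne_zero.2 (NeZero.ne N)))
  have hshift : ∀ a, shiftMatrix N O a * F = F * Matrix.diagonal fun j => ψ (a * j) := by
    intro a
    ext i k
    rw [Matrix.mul_diagonal, Matrix.mul_apply]
    simp only [shiftMatrix, Matrix.of_apply, hF, ite_mul, one_mul, zero_mul,
      Finset.sum_ite_eq, Finset.mem_univ, if_true, ← AddChar.map_add_eq_mul, add_mul]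
  have hsum : (l.map fun a => 2 - shiftMatrix N O a - shiftMatrix N O (-a)).sum * F =
      F * Matrix.diagonal fun j => (l.map (loopValue · (w ^ j.val))).sum := by
    induction l with
    | nil => simp
    | cons a l ih =>
      simp only [List.map_cons, List.sum_cons, add_mul, ih, sub_mul, hshift]
      rw [show (2 : Matrix (ZMod N) (ZMod N) O) * F = F * Matrix.diagonal fun _ => 2 by
        rw [two_mul, ← mul_two]; rfl]
      rw [← mul_sub, ← mul_sub, ← mul_add, Matrix.diagonal_sub, Matrix.diagonal_sub,
        Matrix.diagonal_add]
      simp only [hψval, loopValue]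
  have hmain : circulantLaplacian N O q c l * F =
      F * Matrix.diagonal fun j => (q : O) * (c + (l.map (loopValue · (w ^ j.val))).sum) := by
    rw [circulantLaplacian, mul_assoc, add_mul, hsum, ((Nat.cast_commute c F).eq), ← mul_add,
      ← mul_assoc, ((Nat.cast_commute q F).eq), mul_assoc, ← Matrix.diagonal_natCast,
      ← Matrix.diagonal_natCast, Matrix.diagonal_add, Matrix.diagonal_mul_diagonal]
  have hdet := congrArg Matrix.det hmain
  rw [Matrix.det_mul, Matrix.det_mul, mul_comm, Matrix.det_diagonal] at hdet
  rw [mul_left_cancel₀ hFdet hdet, Finset.prod_mul_distrib, Finset.prod_const, Finset.card_univ,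
    ZMod.card]
  congr 1
  refine Finset.prod_bij (fun j _ => j.val) (fun j _ => Finset.mem_range.2 j.val_lt)
    (fun i _ j _ h => ZMod.val_injective N h) (fun j hj => ?_) fun _ _ => rfl
  exact ⟨j, Finset.mem_univ _, ZMod.val_cast_of_lt (Finset.mem_range.1 hj)⟩

end Circulant

/-! ### Algebraic integers and nonvanishing -/

section AlgebraicIntegers

/-- The ring of algebraic integers in `ℂ`. -/
abbrev AlgInt : Type := integralClosure ℤ ℂ

/-- Otherwise the rational number `1/p` would be integral over `ℤ`, hence an integer. -/
theorem not_isUnit_natCast_algInt {p : ℕ} (hp : p.Prime) : ¬ IsUnit (p : AlgInt) := by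
  intro h
  obtain ⟨y, hy⟩ := h.exists_right_inv
  have hy' : (p : ℂ) * y = 1 := by simpa using congrArg (algebraMap AlgInt ℂ) hy
  have hp0 : (p : ℂ) ≠ 0 := Nat.cast_ne_zero.2 hp.ne_zero
  have hyq : (algebraMap ℚ ℂ (p : ℚ)⁻¹) = y := by
    rw [map_inv₀, map_natCast]
    exact inv_eq_of_mul_eq_one_right hy'
  have hint : IsIntegral ℤ ((p : ℚ)⁻¹) :=
    (isIntegral_algebraMap_iff (algebraMap ℚ ℂ).injective).1 (hyq ▸ y.2)
  obtain ⟨z, hz⟩ := IsIntegrallyClosed.isIntegral_iff.1 hint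
  have hpq : (p : ℚ) ≠ 0 := Nat.cast_ne_zero.2 hp.ne_zero
  have : (p : ℤ) * z = 1 := by
    have : (p : ℚ) * z = 1 := by
      rw [show (z : ℚ) = (p : ℚ)⁻¹ from hz, mul_inv_cancel₀ hpq]
    exact_mod_cast this
  have h1 := Int.isUnit_iff_natAbs_eq.1 (IsUnit.of_mul_eq_one _ this)
  exact hp.one_lt.ne' (by simpa using h1)

/-- A compatible system of primitive `p ^ n`-th roots of unity. -/
theorem exists_rootSystem_algInt (p : ℕ) (hp : 0 < p) :
    ∃ w : ℕ → AlgIntˣ, (∀ n, IsPrimitiveRoot (w n : AlgInt) (p ^ n)) ∧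
      ∀ n, w (n + 1) ^ p = w n := by
  have hprim : ∀ n, IsPrimitiveRoot (Complex.exp (2 * Real.pi * Complex.I / (p ^ n : ℕ))) (p ^ n) :=
    fun n => Complex.isPrimitiveRoot_exp _ (pow_pos hp n).ne'
  let z : ℕ → AlgInt := fun n => ⟨_, (hprim n).isIntegral (pow_pos hp n)⟩
  have hz : ∀ n, IsPrimitiveRoot (z n) (p ^ n) := fun n =>
    IsPrimitiveRoot.of_map_of_injective (f := algebraMap AlgInt ℂ) (hprim n)
      Subtype.val_injective
  refine ⟨fun n => ((hz n).isUnit (pow_pos hp n).ne').unit, fun n => hz n, fun n => ?_⟩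
  refine Units.ext (Subtype.ext ?_)
  change Complex.exp _ ^ p = Complex.exp _
  rw [← Complex.exp_nat_mul]
  congr 1
  have : (p : ℂ) ≠ 0 := Nat.cast_ne_zero.2 hp.ne'
  push_cast
  field_simp
  ring

/-- In `ℂ` a root of unity `u` has absolute value 1, so `2 - u^a - u^(-a) = |1 - u^a|² ≥ 0`, and the
sum is at least `c`. -/
theorem add_sum_loopValue_ne_zero {u : AlgIntˣ} {k : ℕ} (hk : k ≠ 0) (hu : u ^ k = 1) {c : ℕ}
    (hc : 0 < c) (l : List ℤ) : (c : AlgInt) + (l.map (loopValue · u)).sum ≠ 0 := by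
  set v : ℂ := algebraMap AlgInt ℂ u with hv
  have hvk : v ^ k = 1 := by
    rw [hv, ← map_pow, ← Units.val_pow_eq_pow_val, hu, Units.val_one, map_one]
  have hnorm : ‖v‖ = 1 := Complex.norm_eq_one_of_pow_eq_one hvk hk
  have hval : ∀ a : ℤ, algebraMap AlgInt ℂ (loopValue a u) = (Complex.normSq (1 - v ^ a) : ℝ) := by
    intro a
    have hzpow : ∀ b : ℤ, algebraMap AlgInt ℂ ((u ^ b : AlgIntˣ) : AlgInt) = v ^ b := fun b => by
      have := congrArg Units.val (map_zpow (Units.map (algebraMap AlgInt ℂ : AlgInt →* ℂ)) u b)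
      exact this.trans (Units.val_zpow_eq_zpow_val _ _)
    have hna : ‖v ^ a‖ = 1 := by rw [norm_zpow, hnorm, one_zpow]
    have hv0 : v ^ a ≠ 0 := fun h => by simp [h] at hna
    have hconj : (starRingEnd ℂ) (v ^ a) = v ^ (-a) := by
      rw [zpow_neg, Complex.inv_def, Complex.normSq_eq_norm_sq, hna]
      simp
    rw [← Complex.mul_conj, map_sub, map_one, hconj, loopValue, map_sub, map_sub, hzpow, hzpow,
      map_ofNat, zpow_neg]
    linear_combination -(mul_inv_cancel₀ hv0)
  have hsum : ∃ x : ℝ, 0 ≤ x ∧ algebraMap AlgInt ℂ (l.map (loopValue · u)).sum = x := by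
    induction l with
    | nil => exact ⟨0, le_rfl, by simp⟩
    | cons a l ih =>
      obtain ⟨x, hx, h⟩ := ih
      exact ⟨_, add_nonneg (Complex.normSq_nonneg (1 - v ^ a)) hx, by
        rw [List.map_cons, List.sum_cons, map_add, h, hval]; push_cast; rfl⟩
  obtain ⟨x, hx, h⟩ := hsum
  intro h0
  have h1 := congrArg (algebraMap AlgInt ℂ) h0
  rw [map_add, h, map_natCast, map_zero] at h1
  have h2 : (c : ℝ) + x = 0 := by exact_mod_cast h1
  have : (0 : ℝ) < c := Nat.cast_pos.2 hc
  linarith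

end AlgebraicIntegers

/-! ### The two-vertex graph and its layers -/

namespace ZpTower

variable (p : ℕ) [Fact p.Prime] (l : List ℤ) (c q : ℕ)

/-- The graph with two vertices `false` and `true`, with `q` loops at `false` for each entry of `l`
and `c * q` edges between the two vertices. -/
abbrev loopGraph : SerreGraph where
  V := Bool
  E := ((Fin l.length ⊕ Fin c) × Fin q) × Bool
  finite_V := inferInstance
  finite_E := inferInstance
  bar x := (x.1, !x.2)
  s x := Sum.elim (fun _ => false) (fun _ => x.2) x.1.1
  t x := Sum.elim (fun _ => false) (fun _ => !x.2) x.1.1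
  bar_bar x := by simp
  bar_ne x h := by simpa using congrArg Prod.snd h
  s_bar := fun ⟨⟨x, _⟩, b⟩ => by cases x <;> simp
  t_bar := fun ⟨⟨x, _⟩, b⟩ => by cases x <;> simp

/-- The integral voltage whose values at the loops are given by the entries of `l` and that is
trivial on the other edges. -/
def loopVoltageInt (x : (loopGraph l c q).E) : ℤ :=
  Sum.elim (fun r => if x.2 then -l[r] else l[r]) (fun _ => 0) x.1.1

/-- The voltage assignment on `loopGraph l c q` with values the entries of `l`. -/
noncomputable def loopVoltage : (loopGraph l c q).Voltage (Gam p) where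
  toFun x := Multiplicative.ofAdd (loopVoltageInt l c q x : ℤ_[p])
  map_bar := fun ⟨⟨x, _⟩, b⟩ => by
    rw [← ofAdd_neg]
    cases x <;> cases b <;> simp [loopVoltageInt]

/-- The ramification at the vertices of `loopGraph l c q`: unramified at `false`, totally ramified
at `true`. -/
noncomputable abbrev loopInertia (v : (loopGraph l c q).V) : Subgroup (Gam p) := Bool.rec ⊥ ⊤ v

theorem gamQEquiv_proj_intCast (n : ℕ) (a : ℤ) :
    gamQEquiv p n (proj p n (Multiplicative.ofAdd (a : ℤ_[p]))) =
      Multiplicative.ofAdd (a : ZMod (p ^ n)) :=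
  congrArg Multiplicative.ofAdd (map_intCast (PadicInt.toZModPow (p := p) n) a)

/-- The vertices of the `n`-th layer: the elements of `ℤ/p^n` and the totally ramified vertex. -/
noncomputable def layerVertex (n : ℕ) :
    Option (ZMod (p ^ n)) → (derivedGraph (loopVoltage p l c q) (loopInertia p l c q) n).V
  | some i => (⟨false, QuotientGroup.mk ((gamQEquiv p n).symm (Multiplicative.ofAdd i))⟩ :
      Σ v : Bool, GamQ p n ⧸ inertia (loopInertia p l c q) n v)
  | none => (⟨true, QuotientGroup.mk 1⟩ :
      Σ v : Bool, GamQ p n ⧸ inertia (loopInertia p l c q) n v)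

theorem mk_eq_layerVertex_some (n : ℕ) (g : GamQ p n) (j : ZMod (p ^ n)) :
    (⟨false, QuotientGroup.mk g⟩ : Σ v : Bool, GamQ p n ⧸ inertia (loopInertia p l c q) n v) =
      layerVertex p l c q n (some j) ↔ (gamQEquiv p n g).toAdd = j := by
  have hbot : inertia (loopInertia p l c q) n false = ⊥ := Subgroup.map_bot _
  unfold layerVertex
  rw [Sigma.mk.injEq]
  simp only [heq_eq_eq, true_and]
  rw [QuotientGroup.eq, hbot, Subgroup.mem_bot, inv_mul_eq_one, MulEquiv.eq_symm_apply]
  rfl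

theorem mk_eq_layerVertex_none (n : ℕ) (g : GamQ p n) :
    (⟨true, QuotientGroup.mk g⟩ : Σ v : Bool, GamQ p n ⧸ inertia (loopInertia p l c q) n v) =
      layerVertex p l c q n none := by
  have htop : inertia (loopInertia p l c q) n true = ⊤ :=
    Subgroup.map_top_of_surjective _ (QuotientGroup.mk'_surjective _)
  unfold layerVertex
  rw [Sigma.mk.injEq]
  simp only [heq_eq_eq, true_and]
  rw [QuotientGroup.eq, htop]
  exact Subgroup.mem_top _

theorem layerVertex_bijective (n : ℕ) : Function.Bijective (layerVertex p l c q n) := by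
  constructor
  · rintro (_ | i) (_ | j) h
    · rfl
    · exact absurd (show true = false from congrArg Sigma.fst h) (by decide)
    · exact absurd (show false = true from congrArg Sigma.fst h) (by decide)
    · have := (mk_eq_layerVertex_some p l c q n _ j).1 h
      simpa using this
  · rintro ⟨_ | _, x⟩ <;> obtain ⟨g, rfl⟩ := QuotientGroup.mk_surjective x
    · exact ⟨_, ((mk_eq_layerVertex_some p l c q n g _).2 rfl).symm⟩
    · exact ⟨_, (mk_eq_layerVertex_none p l c q n g).symm⟩

theorem isConnected_loopGraph (hc : 0 < c) (hq : 0 < q) : (loopGraph l c q).IsConnected := by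
  refine ⟨⟨true⟩, ?_⟩
  have h : ∀ b, (loopGraph l c q).Joined Set.univ b !b := fun b =>
    .single ⟨((Sum.inr ⟨0, hc⟩, ⟨0, hq⟩), b), trivial, rfl, rfl⟩
  rintro (_ | _) (_ | _)
  · exact .refl
  · exact h false
  · exact h true
  · exact .refl

theorem isConnected_loopLayer (hc : 0 < c) (hq : 0 < q) (n : ℕ) :
    (derivedGraph (loopVoltage p l c q) (loopInertia p l c q) n).IsConnected := by
  refine ⟨⟨layerVertex p l c q n none⟩, ?_⟩
  have hroot : ∀ u, (derivedGraph (loopVoltage p l c q) (loopInertia p l c q) n).Joined Set.univ u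
      (layerVertex p l c q n none) := by
    intro u
    obtain ⟨_ | i, rfl⟩ := (layerVertex_bijective p l c q n).2 u
    · exact .refl
    · exact .single ⟨((gamQEquiv p n).symm (Multiplicative.ofAdd i),
        ((Sum.inr ⟨0, hc⟩, ⟨0, hq⟩), false)), trivial, rfl, mk_eq_layerVertex_none p l c q n _⟩
  exact fun u v => (hroot u).trans ((hroot v).symm fun _ _ => Set.mem_univ _)

-- Contribution of the fibre over one base edge. Over an edge leaving `false`, exactly one lift
-- starts at `i`: for a loop it ends at `i` plus the voltage, and for an edge to the root only the
-- diagonal term survives. Edges leaving the root contribute nothing.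
open scoped Classical in
theorem sum_fibre_reducedLaplacian [Fintype (GamQ p n)] (i j : ZMod (p ^ n))
    (x : (loopGraph l c q).E) :
    (∑ g : GamQ p n, if (derivedGraph (loopVoltage p l c q) (loopInertia p l c q) n).s (g, x) =
        layerVertex p l c q n (some i) then (if i = j then (1 : ℤ) else 0) -
        (if (derivedGraph (loopVoltage p l c q) (loopInertia p l c q) n).t (g, x) =
          layerVertex p l c q n (some j) then 1 else 0) else 0) =
      Sum.elim (fun r => (if i = j then 1 else 0) -
          (if i + ((if x.2 then -l[r] else l[r] : ℤ) : ZMod (p ^ n)) = j then 1 else 0))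
        (fun _ => if x.2 then 0 else if i = j then 1 else 0) x.1.1 := by
  have hsum : ∀ f : GamQ p n → ℤ, (∑ g, if (gamQEquiv p n g).toAdd = i then f g else 0) =
      f ((gamQEquiv p n).symm (Multiplicative.ofAdd i)) := by
    intro f
    rw [← Finset.sum_filter]
    have : (Finset.univ.filter fun g : GamQ p n => (gamQEquiv p n g).toAdd = i) =
        {(gamQEquiv p n).symm (Multiplicative.ofAdd i)} := by
      ext g
      rw [Finset.mem_filter_univ, Finset.mem_singleton, MulEquiv.eq_symm_apply]
      rfl
    rw [this, Finset.sum_singleton]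
  obtain ⟨⟨r | k, y⟩, b⟩ := x
  · have hs : ∀ g, (derivedGraph (loopVoltage p l c q) (loopInertia p l c q) n).s
        (g, ((Sum.inl r, y), b)) = layerVertex p l c q n (some i) ↔ (gamQEquiv p n g).toAdd = i :=
      fun g => mk_eq_layerVertex_some p l c q n g i
    have ht : ∀ g, (derivedGraph (loopVoltage p l c q) (loopInertia p l c q) n).t
        (g, ((Sum.inl r, y), b)) = layerVertex p l c q n (some j) ↔ (gamQEquiv p n g).toAdd +
          ((if b then -l[r] else l[r] : ℤ) : ZMod (p ^ n)) = j := by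
      intro g
      refine (mk_eq_layerVertex_some p l c q n _ j).trans ?_
      rw [map_mul]
      have h : gamQEquiv p n (((loopVoltage p l c q).map (proj p n)).toFun
          ((Sum.inl r, y), b)) = _ := gamQEquiv_proj_intCast p n _
      rw [h]
      rfl
    simp only [hs, ht, hsum, MulEquiv.apply_symm_apply, toAdd_ofAdd, Sum.elim_inl]
  · obtain _ | _ := b
    · have hs : ∀ g, (derivedGraph (loopVoltage p l c q) (loopInertia p l c q) n).s
          (g, ((Sum.inr k, y), false)) = layerVertex p l c q n (some i) ↔
            (gamQEquiv p n g).toAdd = i :=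
        fun g => mk_eq_layerVertex_some p l c q n g i
      have ht : ∀ g, (derivedGraph (loopVoltage p l c q) (loopInertia p l c q) n).t
          (g, ((Sum.inr k, y), false)) ≠ layerVertex p l c q n (some j) :=
        fun g h => absurd (show true = false from congrArg Sigma.fst h) (by decide)
      simp only [hs, ht, hsum, if_false, sub_zero, Sum.elim_inr, Bool.false_eq_true]
    · have hs : ∀ g, (derivedGraph (loopVoltage p l c q) (loopInertia p l c q) n).s
          (g, ((Sum.inr k, y), true)) ≠ layerVertex p l c q n (some i) :=
        fun g h => absurd (show true = false from congrArg Sigma.fst h) (by decide)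
      simp only [hs, if_false, Finset.sum_const_zero, Sum.elim_inr, if_true]

theorem circulantLaplacian_apply {N : ℕ} [NeZero N] (i j : ZMod N) :
    circulantLaplacian N ℤ q c l i j = q * (c * (if i = j then 1 else 0) +
      ∑ r : Fin l.length, (2 * (if i = j then 1 else 0) - (if i + l[r] = j then 1 else 0) -
        (if i + (-l[r] : ℤ) = j then 1 else 0))) := by
  rw [circulantLaplacian, ← Matrix.diagonal_natCast, Matrix.diagonal_mul, Matrix.add_apply,
    ← Fin.sum_univ_fun_getElem, Matrix.sum_apply, ← Matrix.diagonal_natCast, Matrix.diagonal_apply]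
  congr 2
  · simp
  · refine Finset.sum_congr rfl fun r _ => ?_
    rw [Matrix.sub_apply, Matrix.sub_apply, ← Matrix.diagonal_ofNat, Matrix.diagonal_apply]
    simp [shiftMatrix]

/-- The number of spanning trees of the `n`-th layer. -/
theorem kappa_loopLayer (n : ℕ) [NeZero (p ^ n)] :
    ((derivedGraph (loopVoltage p l c q) (loopInertia p l c q) n).kappa : ℤ) =
      (circulantLaplacian (p ^ n) ℤ q c l).det := by
  classical
  let _ : Fintype (GamQ p n) := Fintype.ofFinite _
  let _ : Fintype (derivedGraph (loopVoltage p l c q) (loopInertia p l c q) n).E :=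
    inferInstanceAs (Fintype (GamQ p n × (loopGraph l c q).E))
  rw [SerreGraph.kappa_eq_det (Equiv.ofBijective _ (layerVertex_bijective p l c q n))]
  congr 1
  ext i j
  rw [circulantLaplacian_apply]
  -- The edges of the layer are grouped by their image in the base; the two orientations of a loop
  -- then give the shifts by `a` and `-a`.
  refine (Fintype.sum_prod_type_right (α₁ := GamQ p n) (α₂ := (loopGraph l c q).E) _).trans ?_
  refine (Finset.sum_congr rfl fun x _ => Eq.trans ?_
    (sum_fibre_reducedLaplacian p l c q i j x)).trans ?_
  · congr!
  simp only [Fintype.sum_prod_type, Fintype.sum_sum_type, Fintype.sum_bool, Sum.elim_inl,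
    Sum.elim_inr, if_true, Bool.false_eq_true, if_false, Finset.sum_const, Finset.card_univ,
    Fintype.card_fin, nsmul_eq_mul, ← Finset.mul_sum, zero_add]
  rw [add_comm]
  congr 2
  refine Finset.sum_congr rfl fun r _ => ?_
  ring

end ZpTower

/-! ### Choice of the graph and its Iwasawa invariants -/

theorem theorem1p2 (p : ℕ) [Fact p.Prime] (l m : ℕ) (hl : Even l) :
    ∃ (X : SerreGraph) (α : X.Voltage (ZpTower.Gam p)) (I : X.V → Subgroup (ZpTower.Gam p)) (v w : X.V),
      v ≠ w ∧ (∀ u : X.V, u = v ∨ u = w) ∧ I v = ⊥ ∧ I w = ⊤ ∧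
      X.IsConnected ∧ (ZpTower.derivedCovering α I).IsConnected ∧
      (ZpTower.derivedCovering α I).HasIwasawaInvariants l m := by
  have hp : p.Prime := Fact.out
  obtain ⟨r, hr⟩ := even_iff_exists_two_mul.1 hl
  obtain ⟨c, L, h, hc, hf⟩ := exists_list_add_sum_loopValue (O := AlgInt) p hp.pos r
  obtain ⟨w, hw, hwp⟩ := exists_rootSystem_algInt p hp.pos
  -- Multiplicity `p^m` scales a Laplacian of size `p^n`, hence its determinant by `p^(m p^n)`.
  have hq : 0 < p ^ m := pow_pos hp.pos m
  refine ⟨ZpTower.loopGraph L c (p ^ m), ZpTower.loopVoltage p L c (p ^ m),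
    ZpTower.loopInertia p L c (p ^ m), false, true, by simp, by simp, rfl, rfl,
    ZpTower.isConnected_loopGraph L c _ hc hq, ZpTower.isConnected_loopLayer p L c _ hc hq, ?_⟩
  have hK : ∀ n, (((ZpTower.derivedGraph (ZpTower.loopVoltage p L c (p ^ m))
      (ZpTower.loopInertia p L c (p ^ m)) n).kappa : ℕ) : AlgInt) = (p : AlgInt) ^ (m * p ^ n) *
        ∏ j ∈ Finset.range (p ^ n), (c + (L.map (loopValue · (w n ^ j))).sum) := by
    intro n
    have : NeZero (p ^ n) := ⟨(pow_pos hp.pos n).ne'⟩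
    have h1 := congrArg (Int.castRingHom AlgInt) (ZpTower.kappa_loopLayer p L c (p ^ m) n)
    rw [RingHom.map_det, map_circulantLaplacian, det_circulantLaplacian (hw n), map_natCast,
      Nat.cast_pow, ← pow_mul] at h1
    exact h1
  -- Needed because `padicValNat p 0` is 0 by convention.
  have hK0 : ∀ n, (ZpTower.derivedGraph (ZpTower.loopVoltage p L c (p ^ m))
      (ZpTower.loopInertia p L c (p ^ m)) n).kappa ≠ 0 := by
    intro n h0
    have h1 := hK n
    rw [h0, Nat.cast_zero] at h1
    refine mul_ne_zero (pow_ne_zero _ (Nat.cast_ne_zero.2 hp.ne_zero))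
      (Finset.prod_ne_zero_iff.2 fun j _ => ?_) h1.symm
    refine add_sum_loopValue_ne_zero (pow_pos hp.pos n).ne' ?_ hc L
    have hwn : w n ^ p ^ n = 1 := Units.ext (by simpa using (hw n).pow_eq_one)
    rw [pow_right_comm, hwn, one_pow]
  rw [hr]
  exact exists_padicValNat_eq (not_isUnit_natCast_algInt hp) w hw hwp _ h r m hf _ hK0 hK
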